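/- **Theorem (Yau's Liouville theorem on graphs).** Let $G=(V,E)$ be a locally finite, connected (finite or infinite) simple graph with a symmetric edge weight $\mu:V\times V\to[0,\infty)$ such that $\mu_{xy}>0$ if and only if $x\sim y$ and $\inf_{x\sim y}\mu_{xy}>0$, and let $m:V\to(0,\infty)$ be a measure on the vertices. Write $\deg(x)=\sum_{y\in V}\mu_{xy}$ and assume that $D_m=\sup_{x\in V}\deg(x)/m(x)<\infty$. For $f,g:V\to\mathbb R$ put $$\Delta f(x)=\frac1{m(x)}\sum_{y\in V}\mu_{xy}\,(f(y)-f(x)),\qquad \Gamma(f,g)=\tfrac12\big(\Delta(fg)-f\Delta g-g\Delta f\big),$$ $$\Gamma_2(f,g)=\tfrac12\big(\Delta\Gamma(f,g)-\Gamma(f,\Delta g)-\Gamma(\Delta f,g)\big),\qquad \Gamma(f)=\Gamma(f,f),\quad \Gamma_2(f)=\Gamma_2(f,f).$$ Let $n>0$ be a real number and suppose that $G$ satisfies the exponential curvature dimension inequality $CDE(n,0)$: for every $x\in V$ and every $f:V\to(0,\infty)$ with $\Delta f(x)<0$, $$\Gamma_2(f)(x)-\Gamma\Big(f,\frac{\Gamma(f)}{f}\Big)(x)\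 \ge\ \frac1n\,(\Delta f(x))^2 .$$ Then every positive harmonic function on $G$ (that is, every $u:V\to(0,\infty)$ with $\Delta u=0$ on $V$) is constant. In particular, every bounded function $u:V\to\mathbb R$ with $\Delta u=0$ on $V$ is constant. -/

import Mathlib

namespace WeightedGraph

noncomputable section

/-- The weighted degree of a vertex, that is, the sum of the weights `μ x y` over all `y`. The
weights vanish off the edges, so that the sum runs over the neighbours of `x`. -/
def deg {V : Type*} (G : SimpleGraph V) [G.LocallyFinite] (μ : V → V → ℝ) (x : V) : ℝ :=
  ∑ y ∈ G.neighborFinset x, μ x y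

/-- The Laplace operator of a weighted graph with respect to the vertex measure `m`. -/
def laplacian {V : Type*} (G : SimpleGraph V) [G.LocallyFinite] (μ : V → V → ℝ) (m : V → ℝ)
    (f : V → ℝ) (x : V) : ℝ :=
  1 / m x * ∑ y ∈ G.neighborFinset x, μ x y * (f y - f x)

/-- The gradient form. -/
def gradientForm {V : Type*} (G : SimpleGraph V) [G.LocallyFinite] (μ : V → V → ℝ) (m : V → ℝ)
    (f g : V → ℝ) (x : V) : ℝ :=
  1 / 2 * (laplacian G μ m (fun y => f y * g y) x - f x * laplacian G μ m g x
    - laplacian G μ m f x * g x)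

/-- The iterated gradient form. -/
def iteratedGradientForm {V : Type*} (G : SimpleGraph V) [G.LocallyFinite] (μ : V → V → ℝ)
    (m : V → ℝ) (f g : V → ℝ) (x : V) : ℝ :=
  1 / 2 * (laplacian G μ m (gradientForm G μ m f g) x
    - gradientForm G μ m f (laplacian G μ m g) x
    - gradientForm G μ m (laplacian G μ m f) g x)

/-- The exponential curvature dimension inequality `CDE(n, K)`. -/
def CDE {V : Type*} (G : SimpleGraph V) [G.LocallyFinite] (μ : V → V → ℝ) (m : V → ℝ)
    (n K : ℝ) : Prop :=
  ∀ (x : V) (f : V → ℝ), (∀ y, 0 < f y) → laplacian G μ m f x < 0 →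
    iteratedGradientForm G μ m f f x
        - gradientForm G μ m f (fun y => gradientForm G μ m f f y / f y) x
      ≥ 1 / n * (laplacian G μ m f x) ^ 2 + K * gradientForm G μ m f f x

/-- A function is harmonic if its Laplacian vanishes at every vertex. -/
def IsHarmonic {V : Type*} (G : SimpleGraph V) [G.LocallyFinite] (μ : V → V → ℝ) (m : V → ℝ)
    (u : V → ℝ) : Prop :=
  ∀ x, laplacian G μ m u x = 0

end

end WeightedGraph

namespace WeightedGraph

section

variable {V : Type*} (G : SimpleGraph V) [G.LocallyFinite] (μ : V → V → ℝ) (m : V → ℝ)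

/-! Put `f = √u`. Harmonicity of `f²` gives `Γ(f) = -f Δf`, so `Γ(f)/f = -Δf` and the left side of
CDE collapses to `½ ΔΓ(f)`. With `h = -Δf/f ≥ 0` one has `Γ(f) = h f²`, so CDE reads `(2/n) h² f² ≤
Δ(h f²)` where `h > 0`. Since `h ≤ D` and `f²` is harmonic, the right side is at most `D (sup h - h)
f²`; points where `h` is nearly maximal then force `h = 0`. So `f` and `f²` are both harmonic, which
makes `f` constant. -/

theorem laplacian_neg (f : V → ℝ) (x : V) :
    laplacian G μ m (fun y => -f y) x = -laplacian G μ m f x := by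
  simp only [laplacian]
  rw [← mul_neg, ← Finset.sum_neg_distrib]
  congr 1
  exact Finset.sum_congr rfl fun y _ => by ring

theorem laplacian_add_const (f : V → ℝ) (c : ℝ) (x : V) :
    laplacian G μ m (fun y => f y + c) x = laplacian G μ m f x := by
  simp [laplacian]

theorem gradientForm_comm (f g : V → ℝ) (x : V) :
    gradientForm G μ m f g x = gradientForm G μ m g f x := by
  simp only [gradientForm, mul_comm (f _) (g _)]
  ring

theorem gradientForm_neg_right (f g : V → ℝ) (x : V) :
    gradientForm G μ m f (fun y => -g y) x = -gradientForm G μ m f g x := by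
  simp only [gradientForm, laplacian_neg, mul_neg]
  ring

theorem laplacian_eq_sub_deg (f : V → ℝ) (x : V) :
    laplacian G μ m f x
      = 1 / m x * ∑ y ∈ G.neighborFinset x, μ x y * f y - deg G μ x / m x * f x := by
  simp only [laplacian, deg, mul_sub, Finset.sum_sub_distrib, ← Finset.sum_mul]
  ring

/-- For a function whose square is harmonic, the gradient form is determined by the Laplacian. -/
theorem gradientForm_self_of_isHarmonic_sq {f : V → ℝ}
    (hf : IsHarmonic G μ m fun y => f y * f y) (x : V) :
    gradientForm G μ m f f x = -(f x * laplacian G μ m f x) := by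
  rw [gradientForm, hf x]
  ring

/-- For a positive function whose square is harmonic, the left-hand side of `CDE` reduces to half
the Laplacian of the gradient form. -/
theorem iteratedGradientForm_sub_of_isHarmonic_sq {f : V → ℝ} (hpos : ∀ x, 0 < f x)
    (hf : IsHarmonic G μ m fun y => f y * f y) (x : V) :
    iteratedGradientForm G μ m f f x
        - gradientForm G μ m f (fun y => gradientForm G μ m f f y / f y) x
      = 1 / 2 * laplacian G μ m (gradientForm G μ m f f) x := by
  have key : (fun y => gradientForm G μ m f f y / f y) = fun y => -laplacian G μ m f y := by
    funext y
    rw [gradientForm_self_of_isHarmonic_sq G μ m hf, div_eq_iff (hpos y).ne']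
    ring
  rw [key, gradientForm_neg_right, iteratedGradientForm,
    gradientForm_comm G μ m (laplacian G μ m f) f]
  ring

variable {G μ m}

/-- Only the diagonal term of `Δf` is negative. This makes `h = -Δf/f` bounded. -/
theorem neg_laplacian_le (hμ : ∀ x y, 0 ≤ μ x y) (hm : ∀ x, 0 < m x) {D : ℝ}
    (hD : ∀ x, deg G μ x / m x ≤ D) {f : V → ℝ} (hf : ∀ x, 0 < f x) (x : V) :
    -laplacian G μ m f x ≤ D * f x := by
  have h1 : 0 ≤ 1 / m x * ∑ y ∈ G.neighborFinset x, μ x y * f y :=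
    mul_nonneg (one_div_pos.2 (hm x)).le
      (Finset.sum_nonneg fun y _ => mul_nonneg (hμ x y) (hf y).le)
  have h2 := mul_le_mul_of_nonneg_right (hD x) (hf x).le
  rw [laplacian_eq_sub_deg]
  linarith

/-- The maximum principle for the transform of the Laplacian by a positive harmonic function. -/
theorem laplacian_mul_le (hμ : ∀ x y, 0 ≤ μ x y) (hm : ∀ x, 0 < m x) {D : ℝ}
    (hD : ∀ x, deg G μ x / m x ≤ D) {u : V → ℝ} (hu : ∀ x, 0 < u x)
    (hharm : IsHarmonic G μ m u) {h : V → ℝ} {S : ℝ} (hS : ∀ x, h x ≤ S) (x : V) :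
    laplacian G μ m (fun y => h y * u y) x ≤ D * (S - h x) * u x := by
  have h1 : 1 / m x * ∑ y ∈ G.neighborFinset x, μ x y * (h y * u y)
      ≤ S * (1 / m x * ∑ y ∈ G.neighborFinset x, μ x y * u y) := by
    rw [mul_left_comm S]
    refine mul_le_mul_of_nonneg_left ?_ (one_div_pos.2 (hm x)).le
    rw [Finset.mul_sum]
    refine Finset.sum_le_sum fun y _ => ?_
    rw [mul_left_comm]
    exact mul_le_mul_of_nonneg_right (hS y) (mul_nonneg (hμ x y) (hu y).le)
  have h2 := hharm x
  rw [laplacian_eq_sub_deg, sub_eq_zero] at h2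
  have h3 := mul_le_mul_of_nonneg_right (hD x)
    (mul_nonneg (sub_nonneg.2 (hS x)) (hu x).le)
  rw [h2] at h1
  rw [laplacian_eq_sub_deg]
  linarith

/-- Sum `b² - a² = (b - a)² + 2a(b - a)` over the neighbours. This yields both `Δf ≤ 0` for `f > 0`
and the rigidity when `Δf = 0`. -/
theorem two_mul_mul_laplacian_of_isHarmonic_sq {f : V → ℝ}
    (hf : IsHarmonic G μ m fun y => f y * f y) (x : V) :
    2 * (f x * laplacian G μ m f x)
      = -(1 / m x * ∑ y ∈ G.neighborFinset x, μ x y * (f y - f x) ^ 2) := by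
  have h := hf x
  simp only [laplacian] at h ⊢
  have hs : ∑ y ∈ G.neighborFinset x, μ x y * (f y * f y - f x * f x)
      = ∑ y ∈ G.neighborFinset x, μ x y * (f y - f x) ^ 2
        + 2 * f x * ∑ y ∈ G.neighborFinset x, μ x y * (f y - f x) := by
    rw [Finset.mul_sum, ← Finset.sum_add_distrib]
    exact Finset.sum_congr rfl fun y _ => by ring
  rw [hs] at h
  linarith

/-- A bounded nonnegative function that satisfies the differential inequality of the gradient
estimate at points where it is positive vanishes. -/
theorem eq_zero_of_sq_le_mul_sSup_sub [Nonempty V] {h : V → ℝ} {a D : ℝ} (ha : 0 < a)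
    (hD : 0 ≤ D) (hnonneg : ∀ x, 0 ≤ h x) (hbdd : BddAbove (Set.range h))
    (hle : ∀ x, 0 < h x → a * h x ^ 2 ≤ D * ((⨆ y, h y) - h x)) (x : V) : h x = 0 := by
  set S := ⨆ y, h y with hSdef
  have hS : ∀ y, h y ≤ S := le_ciSup hbdd
  by_contra hx
  have hSpos : 0 < S := ((hnonneg x).lt_of_ne' hx).trans_le (hS x)
  -- The first bound gives `a h(y)² > a S²/4`, the second `D ε ≤ a S²/4`, a contradiction; `D + 1`
  -- allows `D = 0`.
  set ε := min (S / 2) (a * S ^ 2 / (4 * (D + 1))) with hε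
  have hεpos : 0 < ε := lt_min (by positivity) (by positivity)
  obtain ⟨y, hy⟩ := exists_lt_of_lt_ciSup (show S - ε < ⨆ y, h y by linarith)
  have h1 : S / 2 < h y := by linarith [min_le_left (S / 2) (a * S ^ 2 / (4 * (D + 1)))]
  have h2 : ε * (4 * (D + 1)) ≤ a * S ^ 2 := (le_div_iff₀ (by positivity)).1 (min_le_right _ _)
  have h3 := hle y (by linarith)
  have h4 : D * (S - h y) ≤ D * ε := mul_le_mul_of_nonneg_left (by linarith) hD
  have h5 : a * (S / 2) ^ 2 < a * h y ^ 2 :=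
    mul_lt_mul_of_pos_left (pow_lt_pow_left₀ h1 (by positivity) two_ne_zero) ha
  linarith

/-- The square root of a positive harmonic function is harmonic under `CDE(n, 0)`. -/
theorem isHarmonic_of_isHarmonic_sq [Nonempty V] (hμ : ∀ x y, 0 ≤ μ x y) (hm : ∀ x, 0 < m x)
    {D : ℝ} (hD : ∀ x, deg G μ x / m x ≤ D) {n : ℝ} (hn : 0 < n) (hCDE : CDE G μ m n 0)
    {f : V → ℝ} (hpos : ∀ x, 0 < f x) (hf : IsHarmonic G μ m fun y => f y * f y) :
    IsHarmonic G μ m f := by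
  have hD0 : 0 ≤ D := by
    obtain ⟨x⟩ := ‹Nonempty V›
    exact (div_nonneg (Finset.sum_nonneg fun y _ => hμ x y) (hm x).le).trans (hD x)
  set h : V → ℝ := fun x => -laplacian G μ m f x / f x with hdef
  have hmul : ∀ x, h x * f x = -laplacian G μ m f x := fun x => div_mul_cancel₀ _ (hpos x).ne'
  have hnonneg : ∀ x, 0 ≤ h x := fun x => by
    have h1 := two_mul_mul_laplacian_of_isHarmonic_sq hf x
    have h2 : 0 ≤ 1 / m x * ∑ y ∈ G.neighborFinset x, μ x y * (f y - f x) ^ 2 :=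
      mul_nonneg (one_div_pos.2 (hm x)).le
        (Finset.sum_nonneg fun y _ => mul_nonneg (hμ x y) (sq_nonneg _))
    refine div_nonneg (nonneg_of_mul_nonneg_right ?_ (hpos x)) (hpos x).le
    linarith
  have hbdd : BddAbove (Set.range h) := by
    refine ⟨D, ?_⟩
    rintro _ ⟨x, rfl⟩
    exact (div_le_iff₀ (hpos x)).2 (neg_laplacian_le hμ hm hD hpos x)
  have hgrad : gradientForm G μ m f f = fun y => h y * (f y * f y) := by
    funext y
    rw [gradientForm_self_of_isHarmonic_sq G μ m hf, ← mul_assoc, hmul]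
    ring
  have hzero := eq_zero_of_sq_le_mul_sSup_sub (a := 2 / n) (by positivity) hD0 hnonneg hbdd
    fun x hx => by
      have hlap : laplacian G μ m f x = -(h x * f x) := by rw [hmul, neg_neg]
      have h1 := hCDE x f hpos (by rw [hlap]; linarith [mul_pos hx (hpos x)])
      rw [iteratedGradientForm_sub_of_isHarmonic_sq G μ m hpos hf, hgrad, hlap] at h1
      have h2 := laplacian_mul_le hμ hm hD (fun y => mul_pos (hpos y) (hpos y)) hf
        (le_ciSup hbdd) x
      -- Both sides carry the factor `f(x)²`, which cancels.
      refine le_of_mul_le_mul_right ?_ (mul_pos (hpos x) (hpos x))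
      refine le_trans (le_of_eq ?_) ((mul_le_mul_of_nonneg_left h1 zero_le_two).trans ?_)
      · ring
      · linarith
  intro x
  linarith [hmul x, mul_eq_zero_of_left (hzero x) (f x)]

/-- The weighted sum of squared differences vanishes at each vertex, so `f` agrees across every
edge, hence along walks. -/
theorem eq_of_isHarmonic_sq (hG : G.Connected) (hμ : ∀ x y, 0 ≤ μ x y)
    (hadj : ∀ x y, G.Adj x y → 0 < μ x y) (hm : ∀ x, 0 < m x) {f : V → ℝ}
    (hf : IsHarmonic G μ m fun y => f y * f y)
    (hf' : IsHarmonic G μ m f) (x y : V) : f x = f y := by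
  have hstep : ∀ x y, G.Adj x y → f x = f y := fun x y hxy => by
    have h1 := two_mul_mul_laplacian_of_isHarmonic_sq hf x
    rw [hf' x, mul_zero, mul_zero, eq_comm, neg_eq_zero, mul_eq_zero] at h1
    have h2 := (Finset.sum_eq_zero_iff_of_nonneg
      fun z _ => mul_nonneg (hμ x z) (sq_nonneg (f z - f x))).1
      (h1.resolve_left (one_div_pos.2 (hm x)).ne') y ((G.mem_neighborFinset x y).2 hxy)
    have h3 := pow_eq_zero_iff two_ne_zero |>.1
      ((mul_eq_zero.1 h2).resolve_left (hadj x y hxy).ne')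
    linarith
  obtain ⟨p⟩ := hG.preconnected x y
  induction p with
  | nil => rfl
  | cons hxy _ ih => exact (hstep _ _ hxy).trans ih

/-- Positive harmonic functions are constant under `CDE(n, 0)`. -/
theorem eq_of_pos_of_isHarmonic (hG : G.Connected) (hμ : ∀ x y, 0 ≤ μ x y)
    (hadj : ∀ x y, G.Adj x y → 0 < μ x y) (hm : ∀ x, 0 < m x)
    (hDm : BddAbove (Set.range fun x => deg G μ x / m x)) {n : ℝ} (hn : 0 < n)
    (hCDE : CDE G μ m n 0) {u : V → ℝ} (hpos : ∀ x, 0 < u x) (hu : IsHarmonic G μ m u)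
    (x y : V) : u x = u y := by
  obtain ⟨D, hD⟩ := hDm
  have hne : Nonempty V := ⟨x⟩
  have hsq : ∀ z, √(u z) * √(u z) = u z := fun z => Real.mul_self_sqrt (hpos z).le
  have hf : IsHarmonic G μ m fun z => √(u z) * √(u z) := by simpa only [hsq] using hu
  have hfpos : ∀ z, 0 < √(u z) := fun z => Real.sqrt_pos.2 (hpos z)
  have h := eq_of_isHarmonic_sq hG hμ hadj hm hf
    (isHarmonic_of_isHarmonic_sq hμ hm (fun z => hD ⟨z, rfl⟩) hn hCDE hfpos hf) x y
  rw [← hsq x, ← hsq y, h]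

end

end WeightedGraph

theorem mainTheorem6 {V : Type*} (G : SimpleGraph V) [G.LocallyFinite] (hG : G.Connected)
    (μ : V → V → ℝ) (hμ_symm : ∀ x y, μ x y = μ y x) (hμ_nonneg : ∀ x y, 0 ≤ μ x y)
    (hμ_adj : ∀ x y, 0 < μ x y ↔ G.Adj x y)
    (hμ_min : ∃ c : ℝ, 0 < c ∧ ∀ x y, G.Adj x y → c ≤ μ x y)
    (m : V → ℝ) (hm : ∀ x, 0 < m x)
    (hDm : BddAbove (Set.range fun x => WeightedGraph.deg G μ x / m x))
    (n : ℝ) (hn : 0 < n) (hCDE : WeightedGraph.CDE G μ m n 0) :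
    (∀ u : V → ℝ, (∀ x, 0 < u x) → WeightedGraph.IsHarmonic G μ m u →
      ∃ c : ℝ, ∀ x, u x = c) ∧
    (∀ u : V → ℝ, (∃ C : ℝ, ∀ x, |u x| ≤ C) → WeightedGraph.IsHarmonic G μ m u →
      ∃ c : ℝ, ∀ x, u x = c) := by
  obtain ⟨x₀⟩ := hG.nonempty
  have key : ∀ u : V → ℝ, (∀ x, 0 < u x) → WeightedGraph.IsHarmonic G μ m u →
      ∀ x, u x = u x₀ := fun u hpos hu x =>
    WeightedGraph.eq_of_pos_of_isHarmonic hG hμ_nonneg (fun x y => (hμ_adj x y).2) hm hDm hn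
      hCDE hpos hu x x₀
  refine ⟨fun u hpos hu => ⟨u x₀, key u hpos hu⟩, ?_⟩
  rintro u ⟨C, hC⟩ hu
  -- Adding `C + 1` makes `u` positive and keeps it harmonic.
  refine ⟨u x₀, fun x => add_right_cancel (b := C + 1) ?_⟩
  refine key (fun y => u y + (C + 1)) (fun y => ?_) (fun y => ?_) x
  · linarith [neg_le_of_abs_le (hC y)]
  · rw [WeightedGraph.laplacian_add_const]
    exact hu y
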